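/- Let $Z$ be a positive Hermitian Jordan triple system, that is, a finite-dimensional complex vector space with a triple product $\{x,y,z\}$ which is $\mathbb C$-bilinear and symmetric in $(x,z)$ and $\mathbb C$-antilinear in $y$, such that, with $D(a,b)=\{a,b,\,\cdot\,\}$, one has $[D(a,b),D(x,y)]=D(D(a,b)x,y)-D(x,D(b,a)y)$ for all $a,b,x,y\in Z$, and such that $\{x,x,x\}=\lambda x$ with $x\neq 0$ and $\lambda\in\mathbb C$ implies $\lambda>0$. Endow $Z$ with the scalar product $\langle x\vert y\rangle=\operatorname{Tr}D(x,y)$ and with the spectral norm $\|x\|=\|D(x,x)\|^{1/2}$, where $\|D(x,x)\|$ is the operator norm with respect to the scalar product. Let $\mathbf D=\{x\in Z:\|x\|<1\}$ and let $\mathbb D$ be the open unit disc in $\mathbb C$. Put $Q(x)=\{x,\,\cdot\,,x\}$ and $B(x,y)=I-2D(x,y)+Q(x)Q(y)$. For a non-zero tripotent $e$ (i.e. $\{e,e,e\}=e\neq0$) and $k>0$, let \[ D_k(e)=\bigl\{x\in Z:\ \|x\|<1,\ \bigl(\|B(x,e)Q(e)^2\|'\bigr)^{1/2}<k(1-\|x\|^2)\bigr\},\qquad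 \|T\|'=\max_{\|y\|\le1}\|Ty\|. \] Let $e$ be a non-zero tripotent in $Z$. Then the orthogonal projector $\pi$ of $Z$ with range $\mathbb Ce$ exists (with respect to $\langle\,\cdot\,\vert\,\cdot\,\rangle$), and: 1. $\pi(\mathbf D)\subseteq\mathbb De$; 2. $\pi(D_k(e))\subseteq D_k(e)$ for every $k>0$; 3. $\pi$ is a projection device at $e$, in the following sense: $c\mapsto ce$ is a (holomorphic) embedding of $\mathbb D$ into $\mathbf D$ with $ce\to e$ as $c\to1$, and for every continuous curve $\Gamma:[0,1)\to\mathbf D$ with $\Gamma(t)\to e$ as $t\to1^-$ there is a continuous curve $\gamma:[0,1)\to\mathbb D$ with $\gamma(t)\to1$ as $t\to1^-$ and $\pi(\Gamma(t))=\gamma(t)e$ for every $t\in[0,1)$. -/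

import Mathlib

open Set Filter Topology

noncomputable section

/-- A positive Hermitian Jordan triple system on a complex vector space `Z`. The triple product
`{x, y, z} = triple x y z` is linear in `x` and `z` and antilinear in `y`. -/
class PositiveHermitianJTS (Z : Type*) [AddCommGroup Z] [Module ℂ Z] where
  /-- The triple product. -/
  triple : Z →ₗ[ℂ] Z →ₛₗ[starRingEnd ℂ] Z →ₗ[ℂ] Z
  triple_symm : ∀ x y z : Z, triple x y z = triple z y x
  /-- `[D(a,b), D(x,y)] = D(D(a,b)x, y) - D(x, D(b,a)y)`, where `D(a,b) = {a, b, ·}`. -/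
  jordan_identity : ∀ a b x y : Z,
    triple a b ∘ₗ triple x y - triple x y ∘ₗ triple a b
      = triple (triple a b x) y - triple x (triple b a y)
  /-- If `{x,x,x} = c x` with `x ≠ 0` and `c` complex, then `c` is real and positive. -/
  positive : ∀ (x : Z) (c : ℂ), x ≠ 0 → triple x x x = c • x → c.im = 0 ∧ 0 < c.re

namespace PositiveHermitianJTS

variable {Z : Type*} [AddCommGroup Z] [Module ℂ Z] [PositiveHermitianJTS Z]

/-- `D(a,b) z = {a, b, z}`. -/
def D (a b : Z) : Z →ₗ[ℂ] Z := triple a b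

/-- `Q(x) y = {x, y, x}`, an antilinear operator. -/
def Q (x : Z) : Z →ₛₗ[starRingEnd ℂ] Z := (triple x).flip x

theorem Q_apply (x y : Z) : Q x y = triple x y x := rfl

/-- `x` is a tripotent if `{x,x,x} = x`. -/
def IsTripotent (x : Z) : Prop := triple x x x = x

/-- The scalar product `⟨x | y⟩ = Tr D(x,y)`, linear in the first variable. -/
def scalar (x y : Z) : ℂ := LinearMap.trace ℂ Z (D x y)

/-- The norm `|x| = ⟨x | x⟩ ^ (1/2)` of the scalar product. -/
def hilbertNorm (x : Z) : ℝ := √(scalar x x).re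

/-- The operator norm of an endomorphism with respect to `hilbertNorm`. -/
def hilbertOpNorm (T : Z →ₗ[ℂ] Z) : ℝ := sSup {r : ℝ | ∃ y : Z, hilbertNorm y ≤ 1 ∧ r = hilbertNorm (T y)}

/-- The spectral norm `‖x‖ = ‖D(x,x)‖ ^ (1/2)`. -/
def specNorm (x : Z) : ℝ := √(hilbertOpNorm (D x x))

/-- The operator norm `‖T‖'` of an endomorphism with respect to the spectral norm. -/
def specOpNorm (T : Z →ₗ[ℂ] Z) : ℝ := sSup {r : ℝ | ∃ y : Z, specNorm y ≤ 1 ∧ r = specNorm (T y)}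

variable (Z) in
/-- The bounded symmetric domain associated with `Z`: the open unit ball of the spectral norm. -/
def unitBall : Set Z := {x | specNorm x < 1}

/-- The Bergman operator `B(x,y) = I - 2 D(x,y) + Q(x) Q(y)`. -/
def bergman (x y : Z) : Z →ₗ[ℂ] Z := LinearMap.id - (2 : ℂ) • D x y + (Q x).comp (Q y)

/-- The generalized angular region
`D_k(e) = {x : ‖x‖ < 1, (‖B(x,e) Q(e)²‖') ^ (1/2) < k (1 - ‖x‖²)}`. -/
def angularRegion (k : ℝ) (e : Z) : Set Z :=
  {x | specNorm x < 1 ∧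
    √(specOpNorm (bergman x e ∘ₗ (Q e).comp (Q e))) < k * (1 - specNorm x ^ 2)}

/-- `π` is the orthogonal projector of `Z` with range `W`, for the scalar product `Tr D(x,y)`. -/
structure IsOrthogonalProjector (π : Z →ₗ[ℂ] Z) (W : Submodule ℂ Z) : Prop where
  range_eq : LinearMap.range π = W
  orthogonal : ∀ x : Z, ∀ w ∈ W, scalar (x - π x) w = 0

/-- The set `𝔻 e`, where `𝔻` is the open unit disc in `ℂ`. -/
def discMul (e : Z) : Set Z := (fun c : ℂ => c • e) '' Metric.ball 0 1

/-- A `p`-curve in `S`: a continuous curve `[0,1) → S` which tends to `p` at `1`. -/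
structure IsCurveTo {X : Type*} [TopologicalSpace X] (S : Set X) (p : X) (γ : ℝ → X) : Prop where
  continuousOn : ContinuousOn γ (Ico 0 1)
  mapsTo : MapsTo γ (Ico 0 1) S
  tendsto : Tendsto γ (𝓝[<] 1) (𝓝 p)

/-- The map `π` is a projection device at `e`, with (linear, hence holomorphic) embedded disc
`c ↦ c e`: this disc is contained in the domain and ends at `e`, and to every `e`-curve `Γ` in the
domain there corresponds a `1`-curve `γ` in the unit disc such that `π ∘ Γ = γ e`. -/
structure IsProjectionDevice [TopologicalSpace Z] (e : Z) (π : Z → Z) : Prop where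
  disc_injective : Function.Injective (fun c : ℂ => c • e)
  disc_subset : discMul e ⊆ unitBall Z
  disc_tendsto : Tendsto (fun c : ℂ => c • e) (𝓝[Metric.ball 0 1] 1) (𝓝 e)
  curve : ∀ Γ : ℝ → Z, IsCurveTo (unitBall Z) e Γ →
    ∃ γ : ℝ → ℂ, IsCurveTo (Metric.ball 0 1) 1 γ ∧ ∀ t ∈ Ico (0 : ℝ) 1, π (Γ t) = γ t • e

end PositiveHermitianJTS

end

/-! Orthogonality forces π x = t e with t = ⟨x|e⟩/⟨e|e⟩, so everything reduces to two estimates: |t|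
≤ ‖x‖ and |1 - t|² ≤ ‖B(x,e)Q(e)²‖'. The first, `IsTripotent.norm_scalar_le`, is Cauchy–Schwarz for
the positive form (x,y) ↦ ⟨D(x,y)e|e⟩. It gives the inclusion of the ball and, with the continuity
of t, the projection device.

For the second, let w = Q(e)²x be the component of x in the eigenspace Z₁(e) of D(e,e) for the
eigenvalue 1. Since ⟨w|e⟩ = ⟨x|e⟩, the first estimate applied to e - w gives |1 - t| ≤ ‖e - w‖.
Compressed to Z₁(e), the operator B(x,e)Q(e) becomes Q(e - w), and testing it on the sum of the
spectral tripotents of e - w gives `IsTripotent.specNorm_sq_le_specOpNorm_bergman`. Conversely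
B(te,e) is multiplication by (1 - t)² on Z₁(e). So passing from x to te does not increase the left
side of the inequality defining the angular region, nor decrease the right side.

Positivity is only assumed for eigenvectors of the cube, so the spectral theorem `exists_spectral`
has to be derived. The real polynomials p with p(D(x,x))x = 0 form an ideal; positivity makes its
generator split with simple positive roots, and Lagrange interpolation at the roots yields
orthogonal tripotents. With the Peirce relation 2D³ - 3D² + D = 0 for D = D(e,e), this makes the
scalar product positive definite and ‖x‖² the largest spectral value. -/

namespace PositiveHermitianJTS

open Polynomial

/-! ### Power associativity and the odd polynomial calculus. -/

section Powers

variable {Z : Type*} [AddCommGroup Z] [Module ℂ Z] [PositiveHermitianJTS Z]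

theorem jordan_apply (a b x y z : Z) :
    triple a b (triple x y z) = triple x y (triple a b z) + triple (triple a b x) y z
      - triple x (triple b a y) z := by
  have h := LinearMap.congr_fun (jordan_identity a b x y) z
  simp only [LinearMap.sub_apply, LinearMap.comp_apply] at h
  rw [add_sub_assoc, ← h]
  abel

/-- The odd powers `D(x,x)^k x`. -/
noncomputable def oddPow (x : Z) (k : ℕ) : Z := ((triple x x : Module.End ℂ Z) ^ k) x

@[simp] theorem oddPow_zero (x : Z) : oddPow x 0 = x := by simp [oddPow]

theorem triple_self_oddPow (x : Z) (k : ℕ) : triple x x (oddPow x k) = oddPow x (k + 1) := by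
  simp [oddPow, pow_succ']

theorem commutator_triple (a b x y : Z) :
    (triple a b : Module.End ℂ Z) * triple x y - triple x y * triple a b
      = triple (triple a b x) y - triple x (triple b a y) :=
  jordan_identity a b x y

theorem commutator_oddPow (x : Z) (i j : ℕ) :
    (triple x x : Module.End ℂ Z) * triple (oddPow x i) (oddPow x j)
        - triple (oddPow x i) (oddPow x j) * triple x x
      = triple (oddPow x (i + 1)) (oddPow x j) - triple (oddPow x i) (oddPow x (j + 1)) := by
  rw [commutator_triple, triple_self_oddPow, triple_self_oddPow]

/-- Both claims go into one induction: commutation with D(x,x) at level n says, by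
`commutator_oddPow`, that an index can be shifted from one argument to the other at level n + 1. -/
theorem triple_oddPow_aux (x : Z) (n : ℕ) :
    (∀ i j, i + j = n → triple (oddPow x i) (oddPow x j) = triple (oddPow x n) x) ∧
      Commute (triple x x : Module.End ℂ Z) (triple (oddPow x n) x) := by
  induction n with
  | zero =>
    refine ⟨fun i j h => ?_, ?_⟩
    · obtain ⟨rfl, rfl⟩ : i = 0 ∧ j = 0 := by omega
      simp
    · simp
  | succ n ih =>
    obtain ⟨h1, h2⟩ := ih
    have hstep : ∀ i j, i + j = n →
        triple (oddPow x (i + 1)) (oddPow x j) = triple (oddPow x i) (oddPow x (j + 1)) := by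
      intro i j hij
      have h := commutator_oddPow x i j
      rw [h1 i j hij, h2.eq, sub_self] at h
      exact (sub_eq_zero.mp h.symm)
    have hall : ∀ j i, i + j = n + 1 →
        triple (oddPow x i) (oddPow x j) = triple (oddPow x (n + 1)) x := by
      intro j
      induction j with
      | zero =>
        intro i hi
        obtain rfl : i = n + 1 := by omega
        simp
      | succ j ihj =>
        intro i hi
        rw [← hstep i j (by omega)]
        exact ihj (i + 1) (by omega)
    refine ⟨fun i j h => hall j i h, ?_⟩
    set C : Module.End ℂ Z := (triple x x : Module.End ℂ Z) * triple (oddPow x (n + 1)) x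
      - triple (oddPow x (n + 1)) x * triple x x with hC
    have hdiff : ∀ i j, i + j = n + 1 →
        triple (oddPow x (i + 1)) (oddPow x j) = triple (oddPow x i) (oddPow x (j + 1)) + C := by
      intro i j hij
      have h := commutator_oddPow x i j
      rw [hall j i hij, ← hC] at h
      rw [h]
      abel
    have htel : ∀ i j, i + j = n + 2 →
        triple (oddPow x i) (oddPow x j) = triple x (oddPow x (n + 2)) + i • C := by
      intro i
      induction i with
      | zero =>
        intro j hj
        obtain rfl : j = n + 2 := by omega
        simp
      | succ i ihi =>
        intro j hj
        rw [hdiff i j (by omega), ihi (j + 1) (by omega), succ_nsmul, add_assoc]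
    -- Expanding the same commutator with the roles exchanged gives -C as a difference of the two
    -- ends of the telescope, which is also (n + 2)C. Hence (n + 3)C = 0.
    have hrev := commutator_triple (oddPow x (n + 1)) x x x
    have e1 : triple (oddPow x (n + 1)) x x = oddPow x (n + 2) := by
      rw [triple_symm, triple_self_oddPow]
    have e2 : triple x (oddPow x (n + 1)) x = oddPow x (n + 2) := by
      have h := hall (n + 1) 0 (by omega)
      rw [oddPow_zero] at h
      rw [h, e1]
    rw [e1, e2] at hrev
    have hlast := htel (n + 2) 0 (by omega)
    rw [oddPow_zero] at hlast
    rw [hlast] at hrev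
    have h3 : (n + 3) • C = 0 := by
      have : -C = (n + 2) • C := by
        rw [hC, neg_sub, hrev]
        abel
      rw [succ_nsmul, ← this]
      abel
    have h4 : C = 0 := by
      rw [← Nat.cast_smul_eq_nsmul ℂ] at h3
      exact (smul_eq_zero.mp h3).resolve_left (by exact_mod_cast (by omega : n + 3 ≠ 0))
    exact sub_eq_zero.mp (hC ▸ h4)

theorem triple_oddPow (x : Z) (i j : ℕ) :
    triple (oddPow x i) (oddPow x j) = triple (oddPow x (i + j)) x :=
  (triple_oddPow_aux x (i + j)).1 i j rfl

theorem triple_oddPow_apply (x : Z) (i j k : ℕ) :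
    triple (oddPow x i) (oddPow x j) (oddPow x k) = oddPow x (i + j + k + 1) := by
  have h := ((triple_oddPow_aux x (i + j)).2.pow_left k).eq
  have h' := LinearMap.congr_fun h x
  simp only [Module.End.mul_apply] at h'
  change _ = triple (oddPow x (i + j)) x (oddPow x k) at h'
  rw [triple_oddPow, ← h', triple_symm, triple_self_oddPow]
  simp only [oddPow, ← Module.End.mul_apply, ← pow_add]
  congr 2
  omega

/-- The element `p(D(x,x)) x`, for a real polynomial `p`. -/
noncomputable def oddCalc (x : Z) : ℝ[X] →ₗ[ℝ] Z where
  toFun p := aeval (triple x x : Module.End ℂ Z) p x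
  map_add' p q := by simp
  map_smul' a p := by simp

theorem oddCalc_apply (x : Z) (p : ℝ[X]) :
    oddCalc x p = aeval (triple x x : Module.End ℂ Z) p x := rfl

theorem oddCalc_monomial (x : Z) (n : ℕ) (a : ℝ) :
    oddCalc x (monomial n a) = (a : ℂ) • oddPow x n := by
  simp [oddCalc_apply, aeval_monomial, oddPow]

@[simp] theorem oddCalc_one (x : Z) : oddCalc x 1 = x := by simp [oddCalc_apply]

theorem oddCalc_mul (x : Z) (p q : ℝ[X]) :
    oddCalc x (p * q) = aeval (triple x x : Module.End ℂ Z) p (oddCalc x q) := by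
  simp [oddCalc_apply]

theorem triple_oddCalc (x : Z) (p q : ℝ[X]) :
    triple (oddCalc x p) (oddCalc x q) = triple (oddCalc x (p * q)) x := by
  induction p using Polynomial.induction_on' with
  | add p p' hp hp' => simp [add_mul, hp, hp']
  | monomial n a =>
    induction q using Polynomial.induction_on' with
    | add q q' hq hq' => simp [mul_add, hq, hq']
    | monomial m b =>
      rw [monomial_mul_monomial]
      simp only [oddCalc_monomial, map_smul, LinearMap.smul_apply, LinearMap.map_smulₛₗ,
        triple_oddPow, Complex.conj_ofReal, smul_smul, Complex.ofReal_mul, mul_comm]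

theorem triple_oddCalc_apply (x : Z) (p q r : ℝ[X]) :
    triple (oddCalc x p) (oddCalc x q) (oddCalc x r) = oddCalc x (X * p * q * r) := by
  rw [triple_oddCalc, mul_assoc X p q]
  generalize p * q = s
  induction s using Polynomial.induction_on' with
  | add p p' hp hp' => simp [mul_add, add_mul, hp, hp']
  | monomial n a =>
    induction r using Polynomial.induction_on' with
    | add q q' hq hq' => simp [mul_add, hq, hq']
    | monomial m b =>
      have h := triple_oddPow_apply x n 0 m
      rw [oddPow_zero] at h
      rw [X_mul_monomial, monomial_mul_monomial]
      simp only [oddCalc_monomial, map_smul, LinearMap.smul_apply, h, smul_smul,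
        Complex.ofReal_mul, mul_comm]
      congr 2
      omega

/-- The ideal of real polynomials `p` with `p(D(x,x)) x = 0`. -/
noncomputable def annIdeal (x : Z) : Ideal ℝ[X] where
  carrier := {p | oddCalc x p = 0}
  add_mem' {p q} hp hq := by
    simp only [mem_ofPred_eq] at *
    rw [map_add, hp, hq, add_zero]
  zero_mem' := by simp
  smul_mem' p q hq := by
    simp only [mem_ofPred_eq] at *
    rw [smul_eq_mul, oddCalc_mul, hq, map_zero]

theorem annIdeal_ne_bot [FiniteDimensional ℂ Z] (x : Z) : annIdeal x ≠ ⊥ := by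
  intro h
  have hinj : Function.Injective (oddCalc x) := by
    rw [injective_iff_map_eq_zero]
    intro p hp
    have : p ∈ annIdeal x := hp
    rwa [h, Ideal.mem_bot] at this
  have : FiniteDimensional ℝ Z := FiniteDimensional.complexToReal Z
  exact Polynomial.not_finite (R := ℝ) (Module.Finite.of_injective (oddCalc x) hinj)

/-- An element of the odd calculus satisfying `X p³ ≡ b p` with `b ≤ 0` vanishes. -/
theorem mem_annIdeal_of_cube {x : Z} {p : ℝ[X]} {b : ℝ} (hb : b ≤ 0)
    (h : X * p * p * p - C b * p ∈ annIdeal x) : p ∈ annIdeal x := by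
  by_contra hp
  have h1 : triple (oddCalc x p) (oddCalc x p) (oddCalc x p) = (b : ℂ) • oddCalc x p := by
    rw [triple_oddCalc_apply]
    have h2 : oddCalc x (X * p * p * p - C b * p) = 0 := h
    rw [map_sub, sub_eq_zero, C_mul', map_smul] at h2
    rw [h2, Complex.coe_smul]
  have := (positive _ _ hp h1).2
  simp only [Complex.ofReal_re] at this
  linarith

/-- If p² annihilates x, then so does Xp³, so the cube of p(D(x,x))x is zero and positivity applies
with b = 0. -/
theorem annIdeal_isRadical (x : Z) : (annIdeal x).IsRadical := by
  rw [Ideal.isRadical_iff_pow_one_lt 2 one_lt_two]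
  intro p hp
  refine mem_annIdeal_of_cube le_rfl ?_
  have : X * p * p * p - C 0 * p = (X * p) * p ^ 2 := by simp; ring
  rw [this]
  exact Ideal.mul_mem_left _ _ hp

end Powers

end PositiveHermitianJTS

namespace PositiveHermitianJTS

open Polynomial

/-! ### The spectral theorem. -/

section Spectral

variable {Z : Type*} [AddCommGroup Z] [Module ℂ Z] [PositiveHermitianJTS Z]

theorem exists_aeval_eq_of_im_ne_zero {z : ℂ} (hz : z.im ≠ 0) (w : ℂ) :
    ∃ q : ℝ[X], aeval z q = w := by
  refine ⟨C (w.re - w.im / z.im * z.re) + C (w.im / z.im) * X, ?_⟩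
  apply Complex.ext
  · simp
  · simp [hz]

/-- A constant q suffices for negative z. For non-real z, real polynomials take every complex value
at z, so a square root of -1/z can be prescribed. -/
theorem exists_mul_sq_aeval_eq_neg_one {z : ℂ} (hz : ∀ a : ℝ, 0 ≤ a → z ≠ a) {g : ℝ[X]}
    (hg : aeval z g ≠ 0) : ∃ q : ℝ[X], z * (aeval z q * aeval z g) ^ 2 = -1 := by
  by_cases him : z.im = 0
  · obtain ⟨a, rfl⟩ : ∃ a : ℝ, z = a := ⟨z.re, Complex.ext rfl (by simpa using him)⟩
    have ha : a < 0 := by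
      by_contra h
      exact hz a (not_lt.mp h) rfl
    have hga : aeval (a : ℂ) g = ((g.eval a : ℝ) : ℂ) := by
      simpa using aeval_algebraMap_apply ℂ a g
    rw [hga] at hg ⊢
    have hg' : g.eval a ≠ 0 := by exact_mod_cast hg
    refine ⟨C (1 / (√(-a) * g.eval a)), ?_⟩
    rw [aeval_C]
    have hs : √(-a) ^ 2 = -a := Real.sq_sqrt (by linarith)
    have hs0 : √(-a) ≠ 0 := (Real.sqrt_pos.mpr (by linarith)).ne'
    have h : a * (1 / (√(-a) * g.eval a) * g.eval a) ^ 2 = -1 := by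
      have : 1 / (√(-a) * g.eval a) * g.eval a = 1 / √(-a) := by field_simp
      rw [this, div_pow, hs]
      field_simp [ha.ne]
    change (a : ℂ) * (((1 / (√(-a) * g.eval a) : ℝ) : ℂ) * ((g.eval a : ℝ) : ℂ)) ^ 2 = -1
    exact_mod_cast h
  · have hz0 : z ≠ 0 := fun h => him (by simp [h])
    obtain ⟨w, hw⟩ := IsAlgClosed.exists_pow_nat_eq (-1 / z) (n := 2) (by norm_num)
    obtain ⟨q, hq⟩ := exists_aeval_eq_of_im_ne_zero him (w / aeval z g)
    refine ⟨q, ?_⟩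
    rw [hq, div_mul_cancel₀ _ hg, hw]
    field_simp

/-- The complex roots of a generator of `annIdeal x` are positive real numbers. -/
theorem root_pos_of_annIdeal_eq_span {x : Z} {m : ℝ[X]} (hm0 : m ≠ 0)
    (hm : ∀ p, p ∈ annIdeal x ↔ m ∣ p) {z : ℂ} (hz : aeval z m = 0) :
    ∃ a : ℝ, 0 < a ∧ z = a := by
  have hsq : Squarefree m := by
    rw [← isRadical_iff_squarefree_of_ne_zero hm0, isRadical_iff_pow_one_lt 2 one_lt_two]
    intro p hp
    exact (hm p).1 (annIdeal_isRadical x ⟨2, (hm _).2 hp⟩)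
  have hint : IsIntegral ℝ z := Algebra.IsIntegral.isIntegral z
  -- Squarefreeness gives g(z) ≠ 0, so g is outside the ideal. If z is not positive, the cube
  -- criterion will put g, or a multiple of it not vanishing at z, inside.
  obtain ⟨g, hg⟩ := minpoly.dvd ℝ z hz
  have hgz : aeval z g ≠ 0 := by
    intro h
    obtain ⟨k, hk⟩ := minpoly.dvd ℝ z h
    exact (minpoly.irreducible hint).not_isUnit
      (hsq _ ⟨k, by rw [hg]; nth_rewrite 1 [hk]; ring⟩)
  have hnot : ∀ p : ℝ[X], aeval z p ≠ 0 → p ∉ annIdeal x := by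
    intro p hp h
    obtain ⟨k, hk⟩ := (hm p).1 h
    exact hp (by rw [hk, map_mul, hz, zero_mul])
  by_contra hcon
  push Not at hcon
  by_cases h0 : z = 0
  · refine hnot g hgz (mem_annIdeal_of_cube le_rfl ((hm _).2 ?_))
    have : minpoly ℝ z ∣ X := minpoly.dvd ℝ z (by simp [h0])
    have h1 := mul_dvd_mul_right this g
    rw [← hg] at h1
    rw [C_0, zero_mul, sub_zero]
    exact (h1.mul_right g).mul_right g
  · obtain ⟨q, hq⟩ := exists_mul_sq_aeval_eq_neg_one (z := z) (fun a ha h => by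
      rcases ha.eq_or_lt with rfl | ha
      · exact h0 (by simpa using h)
      · exact hcon a ha h) hgz
    refine hnot (q * g) ?_ (mem_annIdeal_of_cube (b := -1) (by norm_num) ((hm _).2 ?_))
    · rw [map_mul]
      intro h
      rw [h] at hq
      norm_num at hq
    · have h1 : minpoly ℝ z ∣ X * (q * g) ^ 2 + 1 :=
        minpoly.dvd ℝ z (by simp only [map_add, map_mul, map_pow, aeval_X, map_one, hq]; ring)
      have h2 := mul_dvd_mul_right h1 g
      rw [← hg] at h2
      have h3 : X * (q * g) * (q * g) * (q * g) - C (-1) * (q * g)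
          = (X * (q * g) ^ 2 + 1) * g * q := by
        rw [C_neg, C_1]
        ring
      rw [h3]
      exact h2.mul_right q

/-- `annIdeal x` consists of the polynomials which vanish on a finite set of positive numbers. -/
theorem exists_finset_annIdeal [FiniteDimensional ℂ Z] (x : Z) :
    ∃ s : Finset ℝ, (∀ a ∈ s, 0 < a) ∧
      ∀ p : ℝ[X], p ∈ annIdeal x ↔ ∀ a ∈ s, p.eval a = 0 := by
  set m := Submodule.IsPrincipal.generator (annIdeal x) with hmdef
  have hm : ∀ p, p ∈ annIdeal x ↔ m ∣ p := fun p =>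
    Submodule.IsPrincipal.mem_iff_generator_dvd (annIdeal x)
  have hm0 : m ≠ 0 := fun h =>
    annIdeal_ne_bot x ((Submodule.IsPrincipal.eq_bot_iff_generator_eq_zero _).2 h)
  have hpos : ∀ a : ℝ, m.eval a = 0 → 0 < a := by
    intro a ha
    obtain ⟨b, hb, hab⟩ := root_pos_of_annIdeal_eq_span hm0 hm (z := (a : ℂ))
      (by simpa [ha] using aeval_algebraMap_apply ℂ a m)
    rwa [Complex.ofReal_inj.mp hab]
  have hsplit : m.Splits := by
    refine Splits.of_splits_map (algebraMap ℝ ℂ) (IsAlgClosed.splits _) ?_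
    intro z hz
    obtain ⟨a, -, rfl⟩ := root_pos_of_annIdeal_eq_span hm0 hm (z := z) (by
      have := (mem_roots'.1 hz).2
      rwa [IsRoot.def, eval_map_algebraMap] at this)
    exact ⟨a, rfl⟩
  have hnodup : m.roots.Nodup := by
    apply nodup_roots
    rw [PerfectField.separable_iff_squarefree, ← isRadical_iff_squarefree_of_ne_zero hm0,
      isRadical_iff_pow_one_lt 2 one_lt_two]
    intro p hp
    exact (hm p).1 (annIdeal_isRadical x ⟨2, (hm _).2 hp⟩)
  refine ⟨m.roots.toFinset, fun a ha => hpos a ?_, fun p => ?_⟩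
  · exact (mem_roots'.1 (Multiset.mem_toFinset.1 ha)).2
  · rw [hm]
    constructor
    · rintro ⟨k, rfl⟩ a ha
      rw [eval_mul, (mem_roots'.1 (Multiset.mem_toFinset.1 ha)).2.eq_zero, zero_mul]
    · intro h
      by_cases hp : p = 0
      · simp [hp]
      refine hsplit.dvd_of_roots_le_roots hm0 ((Multiset.le_iff_subset hnodup).2 fun a ha => ?_)
      exact (mem_roots hp).2 (h a (Multiset.mem_toFinset.2 ha))

/-- The spectral theorem: `x = ∑ √a c_a` with orthogonal non-zero tripotents `c_a`. -/
theorem exists_spectral [FiniteDimensional ℂ Z] (x : Z) :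
    ∃ (s : Finset ℝ) (c : ℝ → Z), (∀ a ∈ s, 0 < a) ∧ (∀ a ∈ s, IsTripotent (c a)) ∧
      (∀ a ∈ s, c a ≠ 0) ∧ (∀ a ∈ s, ∀ b ∈ s, a ≠ b → triple (c a) (c b) = 0) ∧
      x = ∑ a ∈ s, (√a : ℂ) • c a ∧
      ∀ W : Submodule ℂ Z, x ∈ W → (∀ w ∈ W, triple x x w ∈ W) → ∀ a ∈ s, c a ∈ W := by
  classical
  obtain ⟨s, hpos, hs⟩ := exists_finset_annIdeal x
  have hinj : Set.InjOn (id : ℝ → ℝ) s := Function.injective_id.injOn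
  have hone : ∀ a ∈ s, (Lagrange.basis s id a).eval a = 1 := fun a ha =>
    Lagrange.eval_basis_self hinj ha
  have hzero : ∀ a, ∀ b ∈ s, a ≠ b → (Lagrange.basis s id a).eval b = 0 := fun a b hb h =>
    Lagrange.eval_basis_of_ne (v := id) h hb
  have hval : ∀ a ∈ s, ∀ b ∈ s, (Lagrange.basis s id a).eval b = if a = b then 1 else 0 := by
    intro a ha b hb
    split_ifs with h
    · rw [← h, hone a ha]
    · exact hzero a b hb h
  have hsq : ∀ a ∈ s, (√a : ℂ) ≠ 0 := fun a ha => by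
    exact_mod_cast (Real.sqrt_pos.mpr (hpos a ha)).ne'
  have hsq2 : ∀ a ∈ s, (√a : ℂ) * √a = a := fun a ha => by
    exact_mod_cast Real.mul_self_sqrt (hpos a ha).le
  have hcalc : ∀ p q : ℝ[X], (∀ a ∈ s, p.eval a = q.eval a) → oddCalc x p = oddCalc x q := by
    intro p q h
    rw [← sub_eq_zero, ← map_sub]
    exact (hs _).2 fun a ha => by rw [eval_sub, h a ha, sub_self]
  -- The Lagrange polynomials are orthogonal idempotents modulo the ideal, so {v a, v a, v a} = a •
  -- v a; dividing by √a gives a tripotent.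
  set v : ℝ → Z := fun a => oddCalc x (Lagrange.basis s id a) with hv
  refine ⟨s, fun a => (√a : ℂ)⁻¹ • v a, hpos, ?_, ?_, ?_, ?_, ?_⟩
  · intro a ha
    have h1 : triple (v a) (v a) (v a) = (a : ℂ) • v a := by
      rw [hv, triple_oddCalc_apply, Complex.coe_smul, ← map_smul]
      refine hcalc _ _ fun b hb => ?_
      simp only [eval_mul, eval_X, eval_smul, hval a ha b hb]
      split_ifs with h <;> simp [h]
    simp only [IsTripotent, map_smul, LinearMap.smul_apply, LinearMap.map_smulₛₗ, h1, smul_smul,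
      map_inv₀, Complex.conj_ofReal]
    congr 1
    rw [← hsq2 a ha]
    field_simp [hsq a ha]
  · intro a ha h
    have h1 : v a = 0 := (smul_eq_zero.mp h).resolve_left (inv_ne_zero (hsq a ha))
    have h2 := (hs (Lagrange.basis s id a)).1 h1 a ha
    rw [hone a ha] at h2
    exact one_ne_zero h2
  · intro a ha b hb hab
    have h1 : triple (v a) (v b) = 0 := by
      rw [hv, triple_oddCalc, hcalc _ 0 fun d hd => ?_]
      · simp
      · rw [eval_mul, hval a ha d hd, hval b hb d hd]
        split_ifs with h h'
        · exact absurd (h.trans h'.symm) hab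
        all_goals simp
    simp only [map_smul, LinearMap.smul_apply, LinearMap.map_smulₛₗ, h1, smul_zero]
  · have h1 : ∀ a ∈ s, (√a : ℂ) • ((√a : ℂ)⁻¹ • v a) = v a := fun a ha =>
      smul_inv_smul₀ (hsq a ha) _
    rw [Finset.sum_congr rfl h1, hv, ← map_sum, ← hcalc 1 _ fun b hb => ?_, oddCalc_one]
    rw [eval_finsetSum, Finset.sum_congr rfl fun a ha => hval a ha b hb]
    simp [hb]
  -- This clause will place the spectral tripotents of an element of Z₁(e) in Z₁(e).
  · intro W hx hW a ha
    have hpow : ∀ n, oddPow x n ∈ W := by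
      intro n
      induction n with
      | zero => simpa using hx
      | succ n ih => rw [← triple_self_oddPow]; exact hW _ ih
    refine W.smul_mem _ ?_
    rw [hv]
    simp only
    generalize Lagrange.basis s id a = p
    induction p using Polynomial.induction_on' with
    | add p q hp hq => rw [map_add]; exact W.add_mem hp hq
    | monomial n r => rw [oddCalc_monomial]; exact W.smul_mem _ (hpow n)

end Spectral

end PositiveHermitianJTS

namespace PositiveHermitianJTS

open ComplexConjugate

/-! ### Positive semidefinite sesquilinear forms. -/

section Sesquilinear

variable {Z : Type*} [AddCommGroup Z] [Module ℂ Z]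

theorem conj_symm_of_im_self_eq_zero (s : Z →ₗ[ℂ] Z →ₛₗ[starRingEnd ℂ] ℂ)
    (h : ∀ x, (s x x).im = 0) (x y : Z) : conj (s x y) = s y x := by
  have h1 := h (x + y)
  have h2 := h (x + Complex.I • y)
  have hx := h x
  have hy := h y
  simp only [map_add, LinearMap.add_apply, map_smul, LinearMap.smul_apply, LinearMap.map_smulₛₗ,
    smul_eq_mul, Complex.conj_I, Complex.add_im, Complex.mul_im, Complex.mul_re, Complex.neg_re,
    Complex.neg_im, Complex.I_re, Complex.I_im, Complex.add_re, hx, hy] at h1 h2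
  apply Complex.ext
  · rw [Complex.conj_re]
    linarith
  · rw [Complex.conj_im]
    linarith

theorem norm_sq_le_of_nonneg (s : Z →ₗ[ℂ] Z →ₛₗ[starRingEnd ℂ] ℂ)
    (h : ∀ x, (s x x).im = 0) (h0 : ∀ x, 0 ≤ (s x x).re) (x y : Z) :
    ‖s x y‖ ^ 2 ≤ (s x x).re * (s y y).re := by
  let core : PreInnerProductSpace.Core ℂ Z :=
    { inner := fun x y => s y x
      conj_inner_symm := fun x y => conj_symm_of_im_self_eq_zero s h x y
      re_inner_nonneg := h0
      add_left := fun x y z => map_add _ _ _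
      smul_left := fun x y r => by simp }
  have := @InnerProductSpace.Core.inner_mul_inner_self_le ℂ Z _ _ _ core x y
  change ‖s y x‖ * ‖s x y‖ ≤ (s x x).re * (s y y).re at this
  rwa [← conj_symm_of_im_self_eq_zero s h x y, RCLike.norm_conj, ← sq] at this

end Sesquilinear

/-! ### The trace form and the Peirce relations of a tripotent. -/

section Peirce

variable {Z : Type*} [AddCommGroup Z] [Module ℂ Z] [PositiveHermitianJTS Z]

/-- The scalar product as a sesquilinear map. -/
noncomputable def scalarForm : Z →ₗ[ℂ] Z →ₛₗ[starRingEnd ℂ] ℂ :=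
  LinearMap.mk₂'ₛₗ (RingHom.id ℂ) (starRingEnd ℂ) scalar
    (fun x y z => by simp [scalar, D]) (fun c x y => by simp [scalar, D])
    (fun x y z => by simp [scalar, D]) (fun c x y => by simp [scalar, D])

theorem scalarForm_apply (x y : Z) : scalarForm x y = scalar x y := rfl

theorem scalar_eq (x y : Z) : scalar x y = LinearMap.trace ℂ Z (triple x y) := rfl

theorem scalar_add_left (x y z : Z) : scalar (x + y) z = scalar x z + scalar y z := by
  simp [← scalarForm_apply]

theorem scalar_add_right (x y z : Z) : scalar x (y + z) = scalar x y + scalar x z := by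
  simp [← scalarForm_apply]

theorem scalar_sub_left (x y z : Z) : scalar (x - y) z = scalar x z - scalar y z := by
  simp [← scalarForm_apply]

theorem scalar_sub_right (x y z : Z) : scalar x (y - z) = scalar x y - scalar x z := by
  simp [← scalarForm_apply]

theorem scalar_smul_left (c : ℂ) (x y : Z) : scalar (c • x) y = c * scalar x y := by
  simp [← scalarForm_apply]

theorem scalar_smul_right (c : ℂ) (x y : Z) : scalar x (c • y) = conj c * scalar x y := by
  simp [← scalarForm_apply]

theorem scalar_sum_left {ι : Type*} (s : Finset ι) (f : ι → Z) (y : Z) :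
    scalar (∑ i ∈ s, f i) y = ∑ i ∈ s, scalar (f i) y := by
  simp [← scalarForm_apply]

@[simp] theorem scalar_zero_left (y : Z) : scalar 0 y = 0 := by
  simp [← scalarForm_apply]

/-- The adjoint of `D(a,b)` is `D(b,a)`. -/
theorem scalar_triple (a b x y : Z) : scalar (triple a b x) y = scalar x (triple b a y) := by
  have h := congrArg (LinearMap.trace ℂ Z) (commutator_triple a b x y)
  rw [map_sub, LinearMap.trace_mul_comm, sub_self, map_sub] at h
  exact (sub_eq_zero.mp h.symm)

variable {e : Z}

/-- Two instances of the Jordan identity read a = 2q - b and q = 2a - b, with a = D(e,e)Q(e)z, b =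
Q(e)D(e,e)z, q = Q(e)z; hence a = b = q. -/
theorem IsTripotent.triple_Q (he : IsTripotent e) (z : Z) :
    triple e e (triple e z e) = triple e z e ∧ triple e (triple e e z) e = triple e z e := by
  have he' : triple e e e = e := he
  have h1 := jordan_apply e e e z e
  have h2 := jordan_apply e z e e e
  rw [he'] at h1 h2
  rw [triple_symm z e e, triple_symm (triple e z e) e e] at h2
  set a := triple e e (triple e z e)
  set b := triple e (triple e e z) e
  set q := triple e z e
  have hb : b = q + q - a := by rw [h1]; abel
  have h3 : (3 : ℂ) • a = (3 : ℂ) • q := by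
    rw [hb] at h2
    have : (3 : ℂ) • a = q + (q + q) := by
      nth_rewrite 1 [h2]
      module
    rw [this]
    module
  have h4 : a = q := smul_right_injective Z (by norm_num : (3 : ℂ) ≠ 0) h3
  exact ⟨h4, by rw [hb, h4]; abel⟩

theorem IsTripotent.Q_Q (he : IsTripotent e) (z : Z) :
    triple e (triple e z e) e
      = (2 : ℂ) • triple e e (triple e e z) - triple e e z := by
  have he' : triple e e e = e := he
  have h := jordan_apply z e e e e
  rw [he', triple_symm z e e, triple_symm (triple e e z) e e] at h
  linear_combination (norm := module) (1 : ℂ) • h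

/-- Substitute Q(e)² = 2D² - D into D Q(e)² = Q(e)². Thus D = D(e,e) has no eigenvalues other than
0, 1/2, 1. -/
theorem IsTripotent.cubic (he : IsTripotent e) (z : Z) :
    triple e e (triple e e (triple e e z))
      = (3 / 2 : ℂ) • triple e e (triple e e z) - (1 / 2 : ℂ) • triple e e z := by
  have h := (he.triple_Q (triple e z e)).1
  rw [he.Q_Q, map_sub, map_smul] at h
  linear_combination (norm := module) (1 / 2 : ℂ) • h

/-- The trace of D(e,e) counts its eigenvalues: p and q are the ranks of the projections 2D² - D and
4D - 4D² onto the eigenspaces for 1 and 1/2, and e itself lies in the first. -/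
theorem IsTripotent.exists_scalar_self [FiniteDimensional ℂ Z] (he : IsTripotent e) :
    ∃ p q : ℕ, scalar e e = p + q / 2 ∧ (e ≠ 0 → 1 ≤ p) ∧ p ≤ Module.finrank ℂ Z ∧
      q ≤ Module.finrank ℂ Z := by
  set E : Module.End ℂ Z := triple e e with hE
  have hc : ∀ z, E (E (E z)) = (3 / 2 : ℂ) • E (E z) - (1 / 2 : ℂ) • E z := he.cubic
  set P : Module.End ℂ Z := (2 : ℂ) • (E * E) - E with hP
  set H : Module.End ℂ Z := (4 : ℂ) • E - (4 : ℂ) • (E * E) with hH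
  have hPP : IsIdempotentElem P := by
    refine LinearMap.ext fun z => ?_
    simp only [hP, Module.End.mul_apply, LinearMap.sub_apply, LinearMap.smul_apply, map_sub,
      map_smul, hc]
    module
  have hHH : IsIdempotentElem H := by
    refine LinearMap.ext fun z => ?_
    simp only [hH, Module.End.mul_apply, LinearMap.sub_apply, LinearMap.smul_apply, map_sub,
      map_smul, hc]
    module
  have hPH : E = P + (1 / 2 : ℂ) • H := by
    rw [hP, hH]
    module
  refine ⟨Module.finrank ℂ (LinearMap.range P), Module.finrank ℂ (LinearMap.range H), ?_, ?_,
    Submodule.finrank_le _, Submodule.finrank_le _⟩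
  · rw [scalar_eq, ← hE, hPH, map_add, map_smul, (LinearMap.IsIdempotentElem.isProj_range P hPP).trace,
      (LinearMap.IsIdempotentElem.isProj_range H hHH).trace, smul_eq_mul]
    ring
  · intro h0
    have he' : E e = e := he
    rw [Nat.one_le_iff_ne_zero, ← Nat.pos_iff_ne_zero, Module.finrank_pos_iff_exists_ne_zero]
    refine ⟨⟨e, e, ?_⟩, fun h => h0 (congrArg Subtype.val h)⟩
    simp only [hP, Module.End.mul_apply, LinearMap.sub_apply, LinearMap.smul_apply, he']
    module

theorem IsTripotent.scalar_self_im [FiniteDimensional ℂ Z] (he : IsTripotent e) :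
    (scalar e e).im = 0 := by
  obtain ⟨p, q, h, -⟩ := he.exists_scalar_self
  have : (p + q / 2 : ℂ) = ((p + q / 2 : ℝ) : ℂ) := by push_cast; rfl
  rw [h, this, Complex.ofReal_im]

theorem IsTripotent.scalar_self_re [FiniteDimensional ℂ Z] (he : IsTripotent e) :
    (e ≠ 0 → 1 ≤ (scalar e e).re) ∧ 0 ≤ (scalar e e).re ∧
      (scalar e e).re ≤ 2 * Module.finrank ℂ Z := by
  obtain ⟨p, q, h, hp, hp', hq⟩ := he.exists_scalar_self
  have : (p + q / 2 : ℂ) = ((p + q / 2 : ℝ) : ℂ) := by push_cast; rfl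
  rw [h, this, Complex.ofReal_re]
  have h1 : (p : ℝ) ≤ Module.finrank ℂ Z := by exact_mod_cast hp'
  have h2 : (q : ℝ) ≤ Module.finrank ℂ Z := by exact_mod_cast hq
  have h3 : (0 : ℝ) ≤ q := Nat.cast_nonneg q
  have h4 : (0 : ℝ) ≤ p := Nat.cast_nonneg p
  refine ⟨fun h0 => ?_, by linarith, by linarith⟩
  have h5 : (1 : ℝ) ≤ p := by exact_mod_cast hp h0
  linarith

end Peirce

/-! ### Calculus in a spectral decomposition; positivity of the scalar product. -/

section Decomposition

variable {Z : Type*} [AddCommGroup Z] [Module ℂ Z] [PositiveHermitianJTS Z]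

/-- `x = ∑ √a c_a` is a spectral decomposition of `x`. -/
structure IsSpectral (x : Z) (s : Finset ℝ) (c : ℝ → Z) : Prop where
  pos : ∀ a ∈ s, 0 < a
  tripotent : ∀ a ∈ s, IsTripotent (c a)
  ne_zero : ∀ a ∈ s, c a ≠ 0
  orth : ∀ a ∈ s, ∀ b ∈ s, a ≠ b → triple (c a) (c b) = 0
  eq_sum : x = ∑ a ∈ s, (√a : ℂ) • c a

variable {x : Z} {s : Finset ℝ} {c : ℝ → Z}

namespace IsSpectral

theorem triple_sum_right (h : IsSpectral x s c) {a : ℝ} (ha : a ∈ s) (f : ℝ → ℂ) :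
    triple (c a) (∑ b ∈ s, f b • c b) = conj (f a) • triple (c a) (c a) := by
  rw [map_sum, Finset.sum_eq_single_of_mem a ha fun b hb hba => by
    rw [LinearMap.map_smulₛₗ, h.orth a ha b hb hba.symm, smul_zero], LinearMap.map_smulₛₗ]

theorem triple_sum_sum (h : IsSpectral x s c) (f g : ℝ → ℂ) :
    triple (∑ a ∈ s, f a • c a) (∑ b ∈ s, g b • c b)
      = ∑ a ∈ s, (f a * conj (g a)) • triple (c a) (c a) := by
  rw [map_sum triple, LinearMap.sum_apply]
  refine Finset.sum_congr rfl fun a ha => ?_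
  rw [map_smul, LinearMap.smul_apply, h.triple_sum_right ha, smul_smul]

theorem triple_self_sum (h : IsSpectral x s c) {a : ℝ} (ha : a ∈ s) (f : ℝ → ℂ) :
    triple (c a) (c a) (∑ b ∈ s, f b • c b) = f a • c a := by
  have ht : triple (c a) (c a) (c a) = c a := h.tripotent a ha
  rw [map_sum, Finset.sum_eq_single_of_mem a ha fun b hb hba => by
    rw [map_smul, triple_symm, h.orth b hb a ha hba, LinearMap.zero_apply, smul_zero], map_smul, ht]

theorem triple_sum_sum_sum (h : IsSpectral x s c) (f g k : ℝ → ℂ) :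
    triple (∑ a ∈ s, f a • c a) (∑ b ∈ s, g b • c b) (∑ a ∈ s, k a • c a)
      = ∑ a ∈ s, (f a * conj (g a) * k a) • c a := by
  rw [h.triple_sum_sum, LinearMap.sum_apply]
  refine Finset.sum_congr rfl fun a ha => ?_
  rw [LinearMap.smul_apply, h.triple_self_sum ha, smul_smul]

theorem sqrt_mul (h : IsSpectral x s c) {a : ℝ} (ha : a ∈ s) :
    (√a : ℂ) * conj (√a : ℂ) = a := by
  rw [Complex.conj_ofReal]
  exact_mod_cast Real.mul_self_sqrt (h.pos a ha).le

theorem triple_self (h : IsSpectral x s c) :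
    triple x x = ∑ a ∈ s, (a : ℂ) • triple (c a) (c a) := by
  rw [h.eq_sum, h.triple_sum_sum]
  exact Finset.sum_congr rfl fun a ha => by rw [h.sqrt_mul ha]

theorem sum_tripotent (h : IsSpectral x s c) : IsTripotent (∑ a ∈ s, c a) := by
  have := h.triple_sum_sum_sum 1 1 1
  simpa [IsTripotent] using this

theorem triple_sum_self (h : IsSpectral x s c) :
    triple (∑ a ∈ s, c a) (∑ a ∈ s, c a) = ∑ a ∈ s, triple (c a) (c a) := by
  have := h.triple_sum_sum 1 1
  simpa using this

theorem triple_sum_middle (h : IsSpectral x s c) :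
    triple x (∑ a ∈ s, c a) x = ∑ a ∈ s, (a : ℂ) • c a := by
  have := h.triple_sum_sum_sum (fun a => (√a : ℂ)) 1 (fun a => (√a : ℂ))
  rw [← h.eq_sum] at this
  simp only [Pi.one_apply, one_smul, map_one, mul_one] at this
  rw [this]
  refine Finset.sum_congr rfl fun a ha => ?_
  have h1 := h.sqrt_mul ha
  rw [Complex.conj_ofReal] at h1
  rw [h1]

theorem triple_self_apply (h : IsSpectral x s c) {a : ℝ} (ha : a ∈ s) :
    triple x x (c a) = (a : ℂ) • c a := by
  have ht : triple (c a) (c a) (c a) = c a := h.tripotent a ha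
  rw [h.triple_self, LinearMap.sum_apply, Finset.sum_eq_single_of_mem a ha fun b hb hba => by
    rw [LinearMap.smul_apply, triple_symm, h.orth a ha b hb hba.symm, LinearMap.zero_apply,
      smul_zero], LinearMap.smul_apply, ht]

theorem scalar_sum (h : IsSpectral x s c) {a : ℝ} (ha : a ∈ s) (f : ℝ → ℂ) :
    scalar (∑ b ∈ s, f b • c b) (c a) = f a * scalar (c a) (c a) := by
  rw [scalar_sum_left, Finset.sum_eq_single_of_mem a ha fun b hb hba => by
    rw [scalar_smul_left, scalar_eq, h.orth b hb a ha hba, map_zero, mul_zero], scalar_smul_left]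

theorem scalar_self (h : IsSpectral x s c) :
    scalar x x = ∑ a ∈ s, (a : ℂ) * scalar (c a) (c a) := by
  rw [scalar_eq, h.triple_self, map_sum]
  simp [scalar_eq]

end IsSpectral

theorem IsSpectral.scalar_self_re (h : IsSpectral x s c) :
    (scalar x x).re = ∑ a ∈ s, a * (scalar (c a) (c a)).re := by
  rw [h.scalar_self, Complex.re_sum]
  simp

theorem exists_isSpectral [FiniteDimensional ℂ Z] (x : Z) : ∃ s c, IsSpectral x s c ∧
    ∀ W : Submodule ℂ Z, x ∈ W → (∀ w ∈ W, triple x x w ∈ W) → ∀ a ∈ s, c a ∈ W := by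
  obtain ⟨s, c, h1, h2, h3, h4, h5, h6⟩ := exists_spectral x
  exact ⟨s, c, ⟨h1, h2, h3, h4, h5⟩, h6⟩

variable [FiniteDimensional ℂ Z]

theorem scalar_self_im (x : Z) : (scalar x x).im = 0 := by
  obtain ⟨s, c, h, -⟩ := exists_isSpectral x
  rw [h.scalar_self, Complex.im_sum]
  exact Finset.sum_eq_zero fun a ha => by simp [(h.tripotent a ha).scalar_self_im]

theorem scalar_self_re_nonneg (x : Z) : 0 ≤ (scalar x x).re := by
  obtain ⟨s, c, h, -⟩ := exists_isSpectral x
  rw [h.scalar_self_re]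
  exact Finset.sum_nonneg fun a ha =>
    mul_nonneg (h.pos a ha).le (h.tripotent a ha).scalar_self_re.2.1

theorem IsSpectral.le_scalar_self_re (h : IsSpectral x s c) {a : ℝ} (ha : a ∈ s) :
    a ≤ (scalar x x).re := by
  rw [h.scalar_self_re]
  calc a ≤ a * (scalar (c a) (c a)).re :=
        le_mul_of_one_le_right (h.pos a ha).le ((h.tripotent a ha).scalar_self_re.1 (h.ne_zero a ha))
    _ ≤ _ := Finset.single_le_sum (f := fun a => a * (scalar (c a) (c a)).re)
        (fun b hb => mul_nonneg (h.pos b hb).le (h.tripotent b hb).scalar_self_re.2.1) ha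

theorem scalar_self_re_pos (hx : x ≠ 0) : 0 < (scalar x x).re := by
  obtain ⟨s, c, h, -⟩ := exists_isSpectral x
  obtain ⟨a, ha⟩ : s.Nonempty := by
    rw [Finset.nonempty_iff_ne_empty]
    rintro rfl
    exact hx (by simpa using h.eq_sum)
  exact (h.pos a ha).trans_le (h.le_scalar_self_re ha)

theorem conj_scalar (x y : Z) : conj (scalar x y) = scalar y x :=
  conj_symm_of_im_self_eq_zero scalarForm scalar_self_im x y

theorem ofReal_scalar_self (x : Z) : (((scalar x x).re : ℝ) : ℂ) = scalar x x :=
  Complex.ext (by simp) (by simp [scalar_self_im])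

/-- For a tripotent `e`, the operator `D(e,e)` lies between `0` and the identity. -/
theorem IsTripotent.scalar_triple_self {e : Z} (he : IsTripotent e) (v : Z) :
    0 ≤ (scalar (triple e e v) v).re ∧ (scalar (triple e e v) v).re ≤ (scalar v v).re := by
  have hc := he.cubic
  -- P, H, R are the Peirce components of v for the eigenvalues 1, 1/2, 0.
  set P := (2 : ℂ) • triple e e (triple e e v) - triple e e v with hP
  set H := (4 : ℂ) • (triple e e v - triple e e (triple e e v)) with hH
  set R := v - (3 : ℂ) • triple e e v + (2 : ℂ) • triple e e (triple e e v) with hR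
  have h1 : scalar (triple e e v) v = scalar P P + (1 / 2 : ℝ) * scalar H H := by
    simp only [hP, hH, scalar_sub_left, scalar_sub_right, scalar_smul_left, scalar_smul_right,
      ← scalar_triple, hc, map_sub, map_smul, map_ofNat]
    push_cast
    ring
  have h2 : scalar v v = scalar (triple e e v) v + (scalar R R + (1 / 2 : ℝ) * scalar H H) := by
    simp only [hR, hH, scalar_sub_left, scalar_sub_right, scalar_smul_left, scalar_smul_right,
      scalar_add_left, scalar_add_right, ← scalar_triple, hc, map_sub, map_smul, map_ofNat, map_add]
    push_cast
    ring
  have hp := scalar_self_re_nonneg P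
  have hh := scalar_self_re_nonneg H
  have hr := scalar_self_re_nonneg R
  have h1' := congrArg Complex.re h1
  have h2' := congrArg Complex.re h2
  rw [Complex.add_re, Complex.re_ofReal_mul] at h1'
  rw [Complex.add_re, Complex.add_re, Complex.re_ofReal_mul] at h2'
  constructor <;> linarith

end Decomposition

end PositiveHermitianJTS

namespace PositiveHermitianJTS

open ComplexConjugate

/-! ### The spectral norm and its comparison with the Hilbert norm. -/

section Norms

variable {Z : Type*} [AddCommGroup Z] [Module ℂ Z] [PositiveHermitianJTS Z]

/-- The sesquilinear form `(x, y) ↦ ⟨D(x,y) v | v⟩`. -/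
noncomputable def vectorForm (v : Z) : Z →ₗ[ℂ] Z →ₛₗ[starRingEnd ℂ] ℂ :=
  LinearMap.mk₂'ₛₗ (RingHom.id ℂ) (starRingEnd ℂ) (fun x y => scalar (triple x y v) v)
    (fun x y z => by simp [scalar_add_left]) (fun c x y => by simp [scalar_smul_left])
    (fun x y z => by simp [scalar_add_left]) (fun c x y => by simp [scalar_smul_left])

theorem vectorForm_apply (v x y : Z) : vectorForm v x y = scalar (triple x y v) v := rfl

theorem hilbertNorm_nonneg (x : Z) : 0 ≤ hilbertNorm x := Real.sqrt_nonneg _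

theorem specNorm_nonneg (x : Z) : 0 ≤ specNorm x := Real.sqrt_nonneg _

theorem hilbertNorm_smul (a : ℂ) (x : Z) : hilbertNorm (a • x) = ‖a‖ * hilbertNorm x := by
  rw [hilbertNorm, hilbertNorm, scalar_smul_left, scalar_smul_right, ← mul_assoc, Complex.mul_conj,
    Complex.re_ofReal_mul, Complex.normSq_eq_norm_sq, Real.sqrt_mul (sq_nonneg _),
    Real.sqrt_sq (norm_nonneg _)]

theorem specNorm_zero : specNorm (0 : Z) = 0 := by
  have h : {t : ℝ | ∃ y : Z, hilbertNorm y ≤ 1 ∧ t = hilbertNorm (D (0 : Z) 0 y)} = {0} := by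
    ext t
    have h0 : hilbertNorm (0 : Z) = 0 := by simp [hilbertNorm]
    simp only [D, map_zero, LinearMap.zero_apply, h0, mem_ofPred_eq, mem_singleton_iff]
    exact ⟨fun ⟨_, _, h⟩ => h, fun h => ⟨0, by simp [h0], h⟩⟩
  rw [specNorm, hilbertOpNorm, h]
  simp

theorem IsSpectral.scalar_triple_self {x : Z} {s : Finset ℝ} {c : ℝ → Z}
    (h : IsSpectral x s c) (v : Z) :
    (scalar (triple x x v) v).re = ∑ a ∈ s, a * (scalar (triple (c a) (c a) v) v).re := by
  rw [h.triple_self, LinearMap.sum_apply, scalar_sum_left, Complex.re_sum]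
  exact Finset.sum_congr rfl fun a _ => by
    rw [LinearMap.smul_apply, scalar_smul_left, Complex.re_ofReal_mul]

theorem specOpNorm_le {T : Z →ₗ[ℂ] Z} {r : ℝ} (h : ∀ y, specNorm y ≤ 1 → specNorm (T y) ≤ r) :
    specOpNorm T ≤ r := by
  refine csSup_le ⟨_, 0, by simp [specNorm_zero], rfl⟩ ?_
  rintro t ⟨y, hy, rfl⟩
  exact h y hy

variable [FiniteDimensional ℂ Z] {x : Z} {s : Finset ℝ} {c : ℝ → Z}

theorem hilbertNorm_sq (x : Z) : hilbertNorm x ^ 2 = (scalar x x).re :=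
  Real.sq_sqrt (scalar_self_re_nonneg x)

theorem hilbertNorm_pos (hx : x ≠ 0) : 0 < hilbertNorm x := Real.sqrt_pos.mpr (scalar_self_re_pos hx)

theorem scalar_self_im_triple (x v : Z) : (scalar (triple x x v) v).im = 0 := by
  rw [← Complex.conj_eq_iff_im, conj_scalar, scalar_triple]

theorem scalar_triple_self_nonneg (x v : Z) : 0 ≤ (scalar (triple x x v) v).re := by
  obtain ⟨s, c, h, -⟩ := exists_isSpectral x
  rw [h.scalar_triple_self]
  exact Finset.sum_nonneg fun a ha =>
    mul_nonneg (h.pos a ha).le ((h.tripotent a ha).scalar_triple_self v).1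

/-- As forms, D(x,x) = ∑ a D(c_a,c_a) ≤ A ∑ D(c_a,c_a) = A D(u,u) ≤ A, because u = ∑ c_a is again a
tripotent. -/
theorem IsSpectral.scalar_triple_self_le (h : IsSpectral x s c) {A : ℝ} (h0 : 0 ≤ A)
    (hA : ∀ a ∈ s, a ≤ A) (v : Z) :
    (scalar (triple x x v) v).re ≤ A * (scalar v v).re := by
  rw [h.scalar_triple_self]
  calc _ ≤ ∑ a ∈ s, A * (scalar (triple (c a) (c a) v) v).re :=
        Finset.sum_le_sum fun a ha =>
          mul_le_mul_of_nonneg_right (hA a ha) ((h.tripotent a ha).scalar_triple_self v).1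
    _ = A * (scalar (triple (∑ a ∈ s, c a) (∑ a ∈ s, c a) v) v).re := by
        rw [← Finset.mul_sum, h.triple_sum_self, LinearMap.sum_apply, scalar_sum_left,
          Complex.re_sum]
    _ ≤ _ := mul_le_mul_of_nonneg_left (h.sum_tripotent.scalar_triple_self v).2 h0

theorem IsSpectral.scalar_self_le (h : IsSpectral x s c) {A : ℝ} (h0 : 0 ≤ A)
    (hA : ∀ a ∈ s, a ≤ A) : (scalar x x).re ≤ A * (2 * Module.finrank ℂ Z) := by
  rw [h.scalar_self_re]
  calc _ ≤ ∑ a ∈ s, A * (scalar (c a) (c a)).re :=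
        Finset.sum_le_sum fun a ha =>
          mul_le_mul_of_nonneg_right (hA a ha) (h.tripotent a ha).scalar_self_re.2.1
    _ = A * (scalar (∑ a ∈ s, c a) (∑ a ∈ s, c a)).re := by
        rw [← Finset.mul_sum, scalar_eq (∑ a ∈ s, c a), h.triple_sum_self, map_sum,
          Complex.re_sum]
        rfl
    _ ≤ _ := mul_le_mul_of_nonneg_left h.sum_tripotent.scalar_self_re.2.2 h0

/-- Cauchy–Schwarz for the form ⟨D(x,x)·|·⟩ at v and D(x,x)v turns a bound on the quadratic form
into a bound on the operator. -/
theorem hilbertNorm_triple_self_le {r : ℝ} (hr : 0 ≤ r)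
    (h : ∀ v, (scalar (triple x x v) v).re ≤ r * (scalar v v).re) (v : Z) :
    hilbertNorm (triple x x v) ≤ r * hilbertNorm v := by
  by_cases h0 : triple x x v = 0
  · rw [h0]
    simpa [hilbertNorm] using mul_nonneg hr (hilbertNorm_nonneg v)
  have hcs := norm_sq_le_of_nonneg (scalarForm ∘ₗ triple x x)
    (fun v => scalar_self_im_triple x v) (fun v => scalar_triple_self_nonneg x v)
    v (triple x x v)
  change ‖scalar (triple x x v) (triple x x v)‖ ^ 2 ≤ (scalar (triple x x v) v).re
    * (scalar (triple x x (triple x x v)) (triple x x v)).re at hcs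
  have h1 := h v
  have h2 := h (triple x x v)
  have hp := hilbertNorm_pos h0
  rw [← ofReal_scalar_self, Complex.norm_real, Real.norm_eq_abs, sq_abs] at hcs
  rw [← hilbertNorm_sq] at hcs h1 h2
  set n := hilbertNorm (triple x x v)
  have h3 : (n ^ 2) ^ 2 ≤ (r * hilbertNorm v ^ 2) * (r * n ^ 2) :=
    hcs.trans (mul_le_mul h1 h2 (scalar_triple_self_nonneg x _)
      (mul_nonneg hr (sq_nonneg _)))
  have h4 : n ^ 2 ≤ (r * hilbertNorm v) ^ 2 := by
    refine le_of_mul_le_mul_right ?_ (pow_pos hp 2)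
    linarith
  exact (pow_le_pow_iff_left₀ hp.le (mul_nonneg hr (hilbertNorm_nonneg v)) two_ne_zero).1 h4

/-- The spectral norm is the square root of the largest eigenvalue of `D(x,x)`. -/
theorem specNorm_eq_sqrt {r : ℝ} (hr : 0 ≤ r)
    (h : ∀ v, (scalar (triple x x v) v).re ≤ r * (scalar v v).re) {v : Z} (hv : v ≠ 0)
    (hev : triple x x v = (r : ℂ) • v) : specNorm x = √r := by
  have hle : ∀ t ∈ {t : ℝ | ∃ y : Z, hilbertNorm y ≤ 1 ∧ t = hilbertNorm (D x x y)}, t ≤ r := by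
    rintro t ⟨y, hy, rfl⟩
    exact (hilbertNorm_triple_self_le hr h y).trans (mul_le_of_le_one_right hr hy)
  have hp := hilbertNorm_pos hv
  have hn : hilbertNorm (((hilbertNorm v)⁻¹ : ℂ) • v) = 1 := by
    rw [hilbertNorm_smul, norm_inv, Complex.norm_real, Real.norm_eq_abs, abs_of_pos hp,
      inv_mul_cancel₀ hp.ne']
  have hmem : r ∈ {t : ℝ | ∃ y : Z, hilbertNorm y ≤ 1 ∧ t = hilbertNorm (D x x y)} := by
    refine ⟨_, hn.le, ?_⟩
    rw [D, map_smul, hev, smul_comm, hilbertNorm_smul, hn, mul_one, Complex.norm_real,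
      Real.norm_eq_abs, abs_of_nonneg hr]
  rw [specNorm, hilbertOpNorm]
  congr 1
  exact le_antisymm (csSup_le ⟨r, hmem⟩ hle) (le_csSup ⟨r, hle⟩ hmem)

theorem IsSpectral.specNorm_eq (h : IsSpectral x s c) {a : ℝ} (ha : a ∈ s)
    (hmax : ∀ b ∈ s, b ≤ a) : specNorm x = √a :=
  specNorm_eq_sqrt (h.pos a ha).le (h.scalar_triple_self_le (h.pos a ha).le hmax)
    (h.ne_zero a ha) (h.triple_self_apply ha)

/-- A spectral decomposition of `x ≠ 0` together with its largest eigenvalue. -/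
theorem exists_isSpectral_max (hx : x ≠ 0) : ∃ s c a, IsSpectral x s c ∧ a ∈ s ∧
    (∀ b ∈ s, b ≤ a) ∧ specNorm x = √a ∧
    ∀ W : Submodule ℂ Z, x ∈ W → (∀ w ∈ W, triple x x w ∈ W) → ∀ a ∈ s, c a ∈ W := by
  obtain ⟨s, c, h, hW⟩ := exists_isSpectral x
  have hs : s.Nonempty := by
    rw [Finset.nonempty_iff_ne_empty]
    rintro rfl
    exact hx (by simpa using h.eq_sum)
  exact ⟨s, c, s.max' hs, h, s.max'_mem hs, fun b hb => s.le_max' b hb,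
    h.specNorm_eq (s.max'_mem hs) fun b hb => s.le_max' b hb, hW⟩

theorem scalar_triple_self_le_specNorm (x v : Z) :
    (scalar (triple x x v) v).re ≤ specNorm x ^ 2 * (scalar v v).re := by
  by_cases hx : x = 0
  · simp [hx, specNorm_zero]
  obtain ⟨s, c, a, h, ha, hmax, hn, -⟩ := exists_isSpectral_max hx
  rw [hn, Real.sq_sqrt (h.pos a ha).le]
  exact h.scalar_triple_self_le (h.pos a ha).le hmax v

theorem specNorm_smul (k : ℂ) (x : Z) : specNorm (k • x) = ‖k‖ * specNorm x := by
  by_cases hx : x = 0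
  · simp [hx, specNorm_zero]
  obtain ⟨s, c, a, h, ha, hmax, hn, -⟩ := exists_isSpectral_max hx
  have ha0 := (h.pos a ha).le
  have htr : triple (k • x) (k • x) = ((‖k‖ ^ 2 : ℝ) : ℂ) • triple x x := by
    rw [map_smul triple, LinearMap.smul_apply, LinearMap.map_smulₛₗ, smul_smul, Complex.mul_conj,
      Complex.normSq_eq_norm_sq]
  have : specNorm (k • x) = √(‖k‖ ^ 2 * a) := by
    refine specNorm_eq_sqrt (by positivity) (fun v => ?_) (h.ne_zero a ha) ?_
    · rw [htr, LinearMap.smul_apply, scalar_smul_left, Complex.re_ofReal_mul, mul_assoc]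
      exact mul_le_mul_of_nonneg_left (h.scalar_triple_self_le ha0 hmax v) (by positivity)
    · rw [htr, LinearMap.smul_apply, h.triple_self_apply ha, smul_smul]
      push_cast
      rfl
  rw [this, hn, Real.sqrt_mul (by positivity), Real.sqrt_sq (norm_nonneg k)]

theorem IsTripotent.specNorm_eq_one {e : Z} (he : IsTripotent e) (h0 : e ≠ 0) :
    specNorm e = 1 := by
  have he' : triple e e e = e := he
  have := specNorm_eq_sqrt (x := e) (r := 1) zero_le_one
    (fun v => by rw [one_mul]; exact (he.scalar_triple_self v).2) h0 (by simpa using he')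
  rw [this, Real.sqrt_one]

theorem IsTripotent.specNorm_le_one {e : Z} (he : IsTripotent e) : specNorm e ≤ 1 := by
  by_cases h0 : e = 0
  · rw [h0, specNorm_zero]
    exact zero_le_one
  · exact (he.specNorm_eq_one h0).le

/-- Pairing with a tripotent is controlled by the spectral norm. -/
theorem IsTripotent.norm_scalar_le {e : Z} (he : IsTripotent e) (y : Z) :
    ‖scalar y e‖ ≤ specNorm y * (scalar e e).re := by
  have he' : triple e e e = e := he
  have h1 : scalar y e = scalar (triple y e e) e := by
    nth_rewrite 1 [← he']
    rw [← scalar_triple, triple_symm]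
  -- Since ⟨y|e⟩ = ⟨D(y,e)e|e⟩, this reads |⟨y|e⟩|² ≤ ⟨D(y,y)e|e⟩ ⟨e|e⟩.
  have hcs := norm_sq_le_of_nonneg (vectorForm e) (fun v => scalar_self_im_triple v e)
    (fun v => scalar_triple_self_nonneg v e) y e
  simp only [vectorForm_apply, ← h1, he'] at hcs
  have h2 := scalar_triple_self_le_specNorm y e
  have h3 := he.scalar_self_re.2.1
  refine (pow_le_pow_iff_left₀ (norm_nonneg _) (mul_nonneg (specNorm_nonneg y) h3) two_ne_zero).1 ?_
  calc _ ≤ _ := hcs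
    _ ≤ (specNorm y ^ 2 * (scalar e e).re) * (scalar e e).re := mul_le_mul_of_nonneg_right h2 h3
    _ = _ := by ring

theorem specNorm_le_hilbertNorm (x : Z) : specNorm x ≤ hilbertNorm x := by
  by_cases hx : x = 0
  · rw [hx, specNorm_zero]
    exact hilbertNorm_nonneg _
  obtain ⟨s, c, a, h, ha, hmax, hn, -⟩ := exists_isSpectral_max hx
  rw [hn]
  exact Real.sqrt_le_sqrt (h.le_scalar_self_re ha)

theorem hilbertNorm_le_specNorm (x : Z) :
    hilbertNorm x ≤ specNorm x * √(2 * Module.finrank ℂ Z) := by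
  by_cases hx : x = 0
  · simp [hx, specNorm_zero, hilbertNorm]
  obtain ⟨s, c, a, h, ha, hmax, hn, -⟩ := exists_isSpectral_max hx
  rw [hn, ← Real.sqrt_mul (h.pos a ha).le]
  exact Real.sqrt_le_sqrt (h.scalar_self_le (h.pos a ha).le hmax)

/-- With the equivalence of the two norms, this bounds the set whose `sSup` is `specOpNorm`; an
unbounded set would give the default value 0. -/
theorem exists_hilbertNorm_apply_le (T : Z →ₗ[ℂ] Z) :
    ∃ K, 0 ≤ K ∧ ∀ y, hilbertNorm (T y) ≤ K * hilbertNorm y := by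
  let core : InnerProductSpace.Core ℂ Z :=
    { inner := fun x y => scalar y x
      conj_inner_symm := fun x y => conj_scalar x y
      re_inner_nonneg := scalar_self_re_nonneg
      add_left := fun x y z => scalar_add_right _ _ _
      smul_left := fun x y r => scalar_smul_right _ _ _
      definite := fun x hx => by
        by_contra h
        have h1 := scalar_self_re_pos h
        have h2 : scalar x x = 0 := hx
        rw [h2] at h1
        exact lt_irrefl _ h1 }
  let _ : NormedAddCommGroup Z := core.toNormedAddCommGroup
  let _ : InnerProductSpace ℂ Z := InnerProductSpace.ofCore core.toCore
  exact ⟨‖LinearMap.toContinuousLinearMap T‖, norm_nonneg _,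
    fun y => (LinearMap.toContinuousLinearMap T).le_opNorm y⟩

theorem specNorm_apply_le_specOpNorm (T : Z →ₗ[ℂ] Z) {y : Z} (hy : specNorm y ≤ 1) :
    specNorm (T y) ≤ specOpNorm T := by
  obtain ⟨K, hK, hT⟩ := exists_hilbertNorm_apply_le T
  refine le_csSup ⟨K * √(2 * Module.finrank ℂ Z), ?_⟩ ⟨y, hy, rfl⟩
  rintro t ⟨w, hw, rfl⟩
  calc _ ≤ _ := specNorm_le_hilbertNorm _
    _ ≤ _ := hT w
    _ ≤ K * (specNorm w * √(2 * Module.finrank ℂ Z)) :=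
        mul_le_mul_of_nonneg_left (hilbertNorm_le_specNorm w) hK
    _ ≤ _ := mul_le_mul_of_nonneg_left
        (mul_le_of_le_one_left (Real.sqrt_nonneg _) hw) hK

theorem specOpNorm_nonneg (T : Z →ₗ[ℂ] Z) : 0 ≤ specOpNorm T :=
  (specNorm_nonneg _).trans (specNorm_apply_le_specOpNorm T (y := 0) (by simp [specNorm_zero]))

end Norms

end PositiveHermitianJTS

namespace PositiveHermitianJTS

open ComplexConjugate

/-! ### The Peirce space Z₁(e) and its involution Q(e). -/

section PeirceOne

variable {Z : Type*} [AddCommGroup Z] [Module ℂ Z] [PositiveHermitianJTS Z] {e : Z}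

/-- The eigenspace `Z₁(e)` of `D(e,e)` for the eigenvalue `1`. -/
noncomputable def peirceOne (e : Z) : Submodule ℂ Z := LinearMap.ker (triple e e - LinearMap.id)

theorem mem_peirceOne {z : Z} : z ∈ peirceOne e ↔ triple e e z = z := by
  simp [peirceOne, sub_eq_zero]

theorem triple_mem_peirceOne {x y z : Z} (hx : x ∈ peirceOne e) (hy : y ∈ peirceOne e)
    (hz : z ∈ peirceOne e) : triple x y z ∈ peirceOne e := by
  rw [mem_peirceOne] at *
  rw [jordan_apply, hx, hy, hz]
  abel

theorem bergman_apply (x y z : Z) :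
    bergman x y z = z - (2 : ℂ) • triple x y z + triple x (triple y z y) x := rfl

namespace IsTripotent

theorem mem_peirceOne_self (he : IsTripotent e) : e ∈ peirceOne e := mem_peirceOne.2 he

/-- `D(Q(e)p, e) = D(e, p)` for `p` in the Peirce space `Z₁(e)`. -/
theorem triple_Q_left (he : IsTripotent e) {p : Z} (hp : p ∈ peirceOne e) :
    triple (triple e p e) e = triple e p := by
  have he' : triple e e e = e := he
  rw [mem_peirceOne] at hp
  -- The commutator of D(e,p) and D(e,e) is D(Q(e)p, e) - D(e,p) by one expansion and zero by the
  -- other.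
  have h1 := commutator_triple e p e e
  have h2 := commutator_triple e e e p
  rw [triple_symm p e e, hp] at h1
  rw [hp, he', sub_self] at h2
  rw [← sub_eq_zero, ← h1, ← neg_sub, h2, neg_zero]

theorem Q_mem (he : IsTripotent e) (z : Z) : triple e z e ∈ peirceOne e :=
  mem_peirceOne.2 (he.triple_Q z).1

theorem Q_Q_of_mem (he : IsTripotent e) {z : Z} (hz : z ∈ peirceOne e) :
    triple e (triple e z e) e = z := by
  rw [mem_peirceOne] at hz
  rw [he.Q_Q, hz, hz]
  module

/-- `D({p,e,q}, e)` in terms of `Q(e)p` and `Q(e)q`. -/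
theorem two_smul_triple_triple (p q : Z) :
    (2 : ℂ) • triple (triple p e q) e
      = triple q (triple e p e) + triple p (triple e q e) := by
  have h1 := commutator_triple p e q e
  have h2 := commutator_triple q e p e
  rw [triple_symm q e p] at h2
  have h3 := congrArg₂ (· + ·) h1 h2
  simp only [sub_add_sub_cancel, sub_self] at h3
  linear_combination (norm := module) (-1 : ℂ) • h3

/-- `Q(e)` is multiplicative on the Peirce space `Z₁(e)`. -/
theorem Q_triple (he : IsTripotent e) {a b w : Z} (ha : a ∈ peirceOne e)
    (hw : w ∈ peirceOne e) :
    triple e (triple a b w) e = triple (triple e a e) (triple e b e) (triple e w e) := by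
  -- This gives Q(e){a,b,w} = 2{{b,a,e},w,e} - {b,a,Q(e)w}. Moving each of a and w across e by
  -- `triple_Q_left` brings the first term to the form treated by `two_smul_triple_triple`.
  have h1 := jordan_apply b a e w e
  have h2 : triple (triple b a e) w e = triple (triple (triple e a e) e b) e (triple e w e) := by
    have hk : triple b a e = triple (triple e a e) e b := by
      rw [he.triple_Q_left ha, triple_symm]
    rw [hk, triple_symm _ e (triple e w e), he.triple_Q_left hw, triple_symm]
  have h3 := LinearMap.congr_fun (two_smul_triple_triple (e := e) (triple e a e) b)
    (triple e w e)
  rw [he.Q_Q_of_mem ha] at h3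
  simp only [LinearMap.smul_apply, LinearMap.add_apply] at h3
  rw [triple_symm e w (triple b a e), h2] at h1
  linear_combination (norm := module) h1 + h3

theorem Q_isTripotent (he : IsTripotent e) {u : Z} (hu : IsTripotent u) (hm : u ∈ peirceOne e) :
    IsTripotent (triple e u e) := by
  have hu' : triple u u u = u := hu
  rw [IsTripotent, ← he.Q_triple hm hm, hu']

theorem eq_zero_of_eigen (he : IsTripotent e) {v : Z} {k : ℂ} (hk : 2 * k ^ 3 - 3 * k ^ 2 + k ≠ 0)
    (hv : triple e e v = k • v) : v = 0 := by
  have h := he.cubic v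
  simp only [hv, map_smul, smul_smul] at h
  have h' : (2 * k ^ 3 - 3 * k ^ 2 + k) • v = 0 := by
    linear_combination (norm := module) (2 : ℂ) • h
  exact (smul_eq_zero.mp h').resolve_left hk

/-- By the Jordan identity {u,x,w} would have D(e,e)-eigenvalue 1 - k + 1, which is excluded by the
Peirce relation; the cases needed are k = 1/2 and k = 0. -/
theorem triple_eq_zero_of_eigen (he : IsTripotent e) {u w x : Z} (hu : u ∈ peirceOne e)
    (hw : w ∈ peirceOne e) {k : ℝ}
    (hk : 2 * (2 - k) ^ 3 - 3 * (2 - k) ^ 2 + (2 - k) ≠ 0)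
    (hx : triple e e x = (k : ℂ) • x) : triple u x w = 0 := by
  rw [mem_peirceOne] at hu hw
  refine he.eq_zero_of_eigen (k := ((2 - k : ℝ) : ℂ)) (by exact_mod_cast hk) ?_
  rw [jordan_apply, hu, hw, hx, LinearMap.map_smulₛₗ, LinearMap.smul_apply, Complex.conj_ofReal]
  push_cast
  module

/-- `{u, x, w}` depends only on the component of `x` in `Z₁(e)` if `u` and `w` lie in `Z₁(e)`. -/
theorem triple_Q_Q (he : IsTripotent e) {u w : Z} (hu : u ∈ peirceOne e)
    (hw : w ∈ peirceOne e) (x : Z) :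
    triple u (triple e (triple e x e) e) w = triple u x w := by
  have h1 : triple u (triple e e x - triple e e (triple e e x)) w = 0 := by
    refine he.triple_eq_zero_of_eigen hu hw (k := 1 / 2) (by norm_num) ?_
    rw [map_sub, he.cubic]
    push_cast
    module
  have h2 : triple u (x - (3 : ℂ) • triple e e x + (2 : ℂ) • triple e e (triple e e x)) w = 0 := by
    refine he.triple_eq_zero_of_eigen hu hw (k := 0) (by norm_num) ?_
    rw [map_add, map_sub, map_smul, map_smul, he.cubic]
    push_cast
    module
  have h3 : x = triple e (triple e x e) e
      + (4 : ℂ) • (triple e e x - triple e e (triple e e x))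
      + (x - (3 : ℂ) • triple e e x + (2 : ℂ) • triple e e (triple e e x)) := by
    rw [he.Q_Q]
    module
  conv_rhs => rw [h3]
  rw [map_add, LinearMap.add_apply, h2, map_add, LinearMap.add_apply, LinearMap.map_smulₛₗ,
    LinearMap.smul_apply, h1, smul_zero, add_zero, add_zero]

theorem scalar_Q_Q (he : IsTripotent e) {v : Z} (hv : v ∈ peirceOne e) (x : Z) :
    scalar (triple e (triple e x e) e) v = scalar x v := by
  rw [mem_peirceOne] at hv
  rw [he.Q_Q, scalar_sub_left, scalar_smul_left, scalar_triple e e (triple e e x), hv,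
    scalar_triple, hv]
  ring

variable [FiniteDimensional ℂ Z]

/-- The Peirce projection onto `Z₁(e)` is contractive. -/
theorem specNorm_Q_Q_le (he : IsTripotent e) (y : Z) :
    specNorm (triple e (triple e y e) e) ≤ specNorm y := by
  set z := triple e (triple e y e) e with hz
  have hzm : z ∈ peirceOne e := he.Q_mem _
  by_cases h0 : z = 0
  · rw [h0, specNorm_zero]
    exact specNorm_nonneg y
  obtain ⟨s, c, a, h, ha, hmax, hn, hW⟩ := exists_isSpectral_max h0
  have hc := hW (peirceOne e) hzm (fun w hw => triple_mem_peirceOne hzm hzm hw) a ha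
  have ht := h.tripotent a ha
  -- The tripotent of the largest spectral value lies in Z₁(e), so it cannot distinguish y from z:
  -- it norms z and gives a lower bound for ‖y‖.
  have h1 : scalar y (c a) = (√a : ℂ) * scalar (c a) (c a) := by
    rw [← he.scalar_Q_Q hc, ← hz, h.eq_sum]
    exact h.scalar_sum ha _
  have h2 := ht.norm_scalar_le y
  have hp := scalar_self_re_pos (h.ne_zero a ha)
  rw [h1, ← ofReal_scalar_self, norm_mul, Complex.norm_real, Complex.norm_real, Real.norm_eq_abs,
    Real.norm_eq_abs, abs_of_pos hp, abs_of_nonneg (Real.sqrt_nonneg a)] at h2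
  rw [hn]
  exact le_of_mul_le_mul_right h2 hp

end IsTripotent

end PeirceOne

/-! ### The orthogonal projector, angular regions and curves. -/

section Projector

variable {Z : Type*} [AddCommGroup Z] [Module ℂ Z] [PositiveHermitianJTS Z]
  [FiniteDimensional ℂ Z] {e : Z}

theorem scalar_self_ne_zero (he0 : e ≠ 0) : scalar e e ≠ 0 := fun h => by
  have := scalar_self_re_pos he0
  rw [h] at this
  exact lt_irrefl _ this

theorem exists_isOrthogonalProjector (he0 : e ≠ 0) :
    ∃ π : Z →ₗ[ℂ] Z, IsOrthogonalProjector π (Submodule.span ℂ {e}) := by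
  have h0 := scalar_self_ne_zero he0
  have hval : ∀ x, ((scalar e e)⁻¹ • (scalarForm.flip e).smulRight e : Z →ₗ[ℂ] Z) x
      = (scalar x e / scalar e e) • e := by
    intro x
    simp [smul_smul, scalarForm_apply, div_eq_inv_mul]
  refine ⟨(scalar e e)⁻¹ • (scalarForm.flip e).smulRight e, le_antisymm ?_ ?_, ?_⟩
  · rintro _ ⟨x, rfl⟩
    rw [hval]
    exact Submodule.smul_mem _ _ (Submodule.mem_span_singleton_self e)
  · rw [Submodule.span_singleton_le_iff_mem]
    exact ⟨e, by rw [hval, div_self h0, one_smul]⟩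
  · intro x w hw
    obtain ⟨k, rfl⟩ := Submodule.mem_span_singleton.1 hw
    rw [hval, scalar_smul_right, scalar_sub_left, scalar_smul_left, div_mul_cancel₀ _ h0, sub_self,
      mul_zero]

theorem IsOrthogonalProjector.apply_eq {π : Z →ₗ[ℂ] Z}
    (hπ : IsOrthogonalProjector π (Submodule.span ℂ {e})) (he0 : e ≠ 0) (x : Z) :
    π x = (scalar x e / scalar e e) • e := by
  have h0 := scalar_self_ne_zero he0
  have hmem : π x ∈ Submodule.span ℂ {e} := hπ.range_eq ▸ LinearMap.mem_range_self π x
  obtain ⟨k, hk⟩ := Submodule.mem_span_singleton.1 hmem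
  have h := hπ.orthogonal x e (Submodule.mem_span_singleton_self e)
  rw [← hk, scalar_sub_left, scalar_smul_left, sub_eq_zero] at h
  rw [← hk, h, mul_div_cancel_right₀ _ h0]

/-- The coefficient of the orthogonal projection onto `ℂe` is at most the spectral norm. -/
theorem IsTripotent.norm_scalar_div_le (he : IsTripotent e) (he0 : e ≠ 0) (x : Z) :
    ‖scalar x e / scalar e e‖ ≤ specNorm x := by
  have hp := scalar_self_re_pos he0
  rw [norm_div, ← ofReal_scalar_self, Complex.norm_real, Real.norm_eq_abs, abs_of_pos hp,
    div_le_iff₀ hp]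
  exact he.norm_scalar_le x

/-- On Z₁(e), the range of Q(e)², the operator B(ke,e) is 1 - 2k + k², and Q(e)² is contractive. -/
theorem IsTripotent.specOpNorm_bergman_smul_le (he : IsTripotent e) (k : ℂ) :
    specOpNorm (bergman (k • e) e ∘ₗ (Q e).comp (Q e)) ≤ ‖1 - k‖ ^ 2 := by
  refine specOpNorm_le fun y hy => ?_
  have h1 : (bergman (k • e) e ∘ₗ (Q e).comp (Q e)) y
      = (1 - k) ^ 2 • triple e (triple e y e) e := by
    change bergman (k • e) e (triple e (triple e y e) e) = _
    have hm := he.Q_mem (triple e y e)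
    set w := triple e (triple e y e) e
    have hm' := mem_peirceOne.1 hm
    rw [bergman_apply, map_smul triple, LinearMap.smul_apply, LinearMap.smul_apply,
      LinearMap.smul_apply, map_smul, LinearMap.smul_apply, he.Q_Q_of_mem hm, hm']
    module
  rw [h1, specNorm_smul, norm_pow]
  exact mul_le_of_le_one_right (sq_nonneg _) ((he.specNorm_Q_Q_le y).trans hy)

/-- The test vector is y = Q(e)u, with u the sum of the spectral tripotents of e - w; being a
tripotent, it has norm at most 1. The Z₁(e)-part of B(x,e)y pairs with c_a as Q(e - w)u = ∑ b c_b
does, and the largest b is ‖e - w‖². -/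
theorem IsTripotent.specNorm_sq_le_specOpNorm_bergman (he : IsTripotent e) (x : Z) :
    specNorm (e - triple e (triple e x e) e) ^ 2
      ≤ specOpNorm (bergman x e ∘ₗ (Q e).comp (Q e)) := by
  set w := triple e (triple e x e) e with hw
  have hwm : w ∈ peirceOne e := he.Q_mem _
  have hem := he.mem_peirceOne_self
  have hzm : e - w ∈ peirceOne e := Submodule.sub_mem _ hem hwm
  by_cases h0 : e - w = 0
  · rw [h0, specNorm_zero, zero_pow two_ne_zero]
    exact specOpNorm_nonneg _
  obtain ⟨s, c, a, h, ha, hmax, hn, hW⟩ := exists_isSpectral_max h0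
  have hc := hW (peirceOne e) hzm fun w hw => triple_mem_peirceOne hzm hzm hw
  have hca := hc a ha
  set u := ∑ b ∈ s, c b with hu
  have hum : u ∈ peirceOne e := Submodule.sum_mem _ fun b hb => hc b hb
  set y := triple e u e with hy
  have hym : y ∈ peirceOne e := he.Q_mem u
  have hye : triple e y e = u := he.Q_Q_of_mem hum
  have hyt : IsTripotent y := he.Q_isTripotent h.sum_tripotent hum
  have hBy : (bergman x e ∘ₗ (Q e).comp (Q e)) y = bergman x e y := by
    change bergman x e (triple e (triple e y e) e) = _
    rw [he.Q_Q_of_mem hym]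
  -- Pairing with an element of Z₁(e) lets x be replaced by its component w, here and in the
  -- quadratic term.
  have h1 : scalar (triple x e y) (c a) = scalar (triple w e y) (c a) := by
    rw [triple_symm x e y, triple_symm w e y, scalar_triple, scalar_triple, hw,
      he.scalar_Q_Q (triple_mem_peirceOne hem hym hca)]
  have h2 : scalar (triple x u x) (c a) = scalar (triple w u w) (c a) := by
    rw [scalar_triple, scalar_triple w u w, ← he.triple_Q_Q hum hca x, ← hw]
    nth_rewrite 2 [hw]
    rw [he.scalar_Q_Q (triple_mem_peirceOne hum hwm hca)]
  have h3 : triple (e - w) u (e - w) = y - (2 : ℂ) • triple w e y + triple w u w := by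
    have : triple e u w = triple w e y := by
      rw [← he.triple_Q_left hum, triple_symm]
    simp only [map_sub, LinearMap.sub_apply, triple_symm w u e, this, ← hy]
    module
  have h4 : scalar (bergman x e y) (c a) = (a : ℂ) * scalar (c a) (c a) := by
    rw [← h.scalar_sum ha (fun b => (b : ℂ)), ← h.triple_sum_middle, ← hu, h3, bergman_apply, hye]
    simp only [scalar_add_left, scalar_sub_left, scalar_smul_left, h1, h2]
  have h5 := (h.tripotent a ha).norm_scalar_le (bergman x e y)
  have hp := scalar_self_re_pos (h.ne_zero a ha)
  rw [h4, ← ofReal_scalar_self, norm_mul, Complex.norm_real, Complex.norm_real, Real.norm_eq_abs,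
    Real.norm_eq_abs, abs_of_pos hp, abs_of_pos (h.pos a ha)] at h5
  rw [hn, Real.sq_sqrt (h.pos a ha).le]
  refine (le_of_mul_le_mul_right h5 hp).trans ?_
  rw [← hBy]
  exact specNorm_apply_le_specOpNorm _ hyt.specNorm_le_one

theorem IsTripotent.projection_mem_angularRegion (he : IsTripotent e) (he0 : e ≠ 0) {k : ℝ}
    (hk : 0 < k) {x : Z} (hx : x ∈ angularRegion k e) :
    (scalar x e / scalar e e) • e ∈ angularRegion k e := by
  obtain ⟨hx1, hx2⟩ := hx
  set t := scalar x e / scalar e e with ht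
  have hle : ‖t‖ ≤ specNorm x := he.norm_scalar_div_le he0 x
  have h0 := scalar_self_ne_zero he0
  have hn : specNorm (t • e) = ‖t‖ := by rw [specNorm_smul, he.specNorm_eq_one he0, mul_one]
  have h1 : ‖1 - t‖ ≤ specNorm (e - triple e (triple e x e) e) := by
    -- The coefficient of e - w along e is 1 - t, because x and w have the same pairing with e.
    have := he.norm_scalar_div_le he0 (e - triple e (triple e x e) e)
    rwa [scalar_sub_left, he.scalar_Q_Q he.mem_peirceOne_self, sub_div, div_self h0] at this
  have h2 : specOpNorm (bergman (t • e) e ∘ₗ (Q e).comp (Q e))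
      ≤ specOpNorm (bergman x e ∘ₗ (Q e).comp (Q e)) :=
    (he.specOpNorm_bergman_smul_le t).trans
      ((pow_le_pow_left₀ (norm_nonneg _) h1 2).trans (he.specNorm_sq_le_specOpNorm_bergman x))
  refine ⟨hn.trans_lt (hle.trans_lt hx1), ?_⟩
  calc _ ≤ _ := Real.sqrt_le_sqrt h2
    _ < _ := hx2
    _ ≤ _ := by
      rw [hn]
      have := pow_le_pow_left₀ (norm_nonneg t) hle 2
      exact mul_le_mul_of_nonneg_left (by linarith) hk.le

theorem IsTripotent.isProjectionDevice [TopologicalSpace Z] [IsTopologicalAddGroup Z]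
    [ContinuousSMul ℂ Z] [T2Space Z] (he : IsTripotent e) (he0 : e ≠ 0) {π : Z → Z}
    (hπ : ∀ x, π x = (scalar x e / scalar e e) • e) : IsProjectionDevice e π := by
  have h0 := scalar_self_ne_zero he0
  -- In finite dimension every linear functional is continuous for the given Hausdorff vector
  -- topology, so it need not be compared with the spectral norm.
  have hcont : Continuous fun x : Z => scalar x e / scalar e e :=
    (LinearMap.continuous_of_finiteDimensional (scalarForm.flip e : Z →ₗ[ℂ] ℂ)).div_const _
  refine ⟨smul_left_injective ℂ he0, ?_, ?_, ?_⟩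
  · rintro _ ⟨k, hk, rfl⟩
    rw [mem_ball_zero_iff] at hk
    change specNorm (k • e) < 1
    rwa [specNorm_smul, he.specNorm_eq_one he0, mul_one]
  · have h : Tendsto (fun k : ℂ => k • e) (𝓝 1) (𝓝 ((1 : ℂ) • e)) :=
      (continuous_id.smul continuous_const).tendsto 1
    rw [one_smul] at h
    exact h.mono_left nhdsWithin_le_nhds
  · intro Γ hΓ
    refine ⟨fun t => scalar (Γ t) e / scalar e e, ⟨?_, ?_, ?_⟩, fun t _ => hπ _⟩
    · exact hcont.comp_continuousOn hΓ.continuousOn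
    · intro t ht
      rw [mem_ball_zero_iff]
      exact (he.norm_scalar_div_le he0 _).trans_lt (hΓ.mapsTo ht)
    · have h := (hcont.tendsto e).comp hΓ.tendsto
      rwa [div_self h0] at h

end Projector

end PositiveHermitianJTS

theorem mainTheorem12 {Z : Type*} [AddCommGroup Z] [Module ℂ Z] [FiniteDimensional ℂ Z]
    [TopologicalSpace Z] [IsTopologicalAddGroup Z] [ContinuousSMul ℂ Z] [T2Space Z]
    [PositiveHermitianJTS Z]
    (e : Z) (he : PositiveHermitianJTS.IsTripotent e) (he0 : e ≠ 0) :
    (∃ π : Z →ₗ[ℂ] Z, PositiveHermitianJTS.IsOrthogonalProjector π (Submodule.span ℂ {e})) ∧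
    ∀ π : Z →ₗ[ℂ] Z, PositiveHermitianJTS.IsOrthogonalProjector π (Submodule.span ℂ {e}) →
      π '' PositiveHermitianJTS.unitBall Z ⊆ PositiveHermitianJTS.discMul e ∧
      (∀ k : ℝ, 0 < k →
        π '' PositiveHermitianJTS.angularRegion k e ⊆ PositiveHermitianJTS.angularRegion k e) ∧
      PositiveHermitianJTS.IsProjectionDevice e π := by
  refine ⟨PositiveHermitianJTS.exists_isOrthogonalProjector he0, fun π hπ => ?_⟩
  have hval := hπ.apply_eq he0
  refine ⟨?_, fun k hk => ?_, he.isProjectionDevice he0 hval⟩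
  · rintro _ ⟨x, hx, rfl⟩
    rw [hval]
    refine ⟨_, ?_, rfl⟩
    rw [mem_ball_zero_iff]
    exact (he.norm_scalar_div_le he0 x).trans_lt hx
  · rintro _ ⟨x, hx, rfl⟩
    rw [hval]
    exact he.projection_mem_angularRegion he0 hk hx
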